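/- Let $\Omega\subset\mathbb R^2$ be a bounded measurable region and let $\rho$ be a measurable density on $\Omega$ with $0<\underline\rho\le\rho\le\bar\rho$. Let $N\ge 1$ and read all indices cyclically modulo $N$. For phase angles $\varphi_1,\dots,\varphi_N$ (taken modulo $2\pi$) and reference points $\mathbf r_1,\dots,\mathbf r_N\in\mathbb R^2$, let $\Omega_i$ be the set of all points of $\Omega$ that lie in the closed sector with apex $\mathbf r_i$ swept counterclockwise from the direction $(\cos\varphi_i,\sin\varphi_i)$ to the direction $(\cos\varphi_{i+1},\sin\varphi_{i+1})$, and let $m_i=\int_{\Omega_i}\rho(\mathbf q)\,d\mathbf q$, a function of $(\varphi_i,\varphi_{i+1},\mathbf r_i)$. Let $\kappa_\varphi,\kappa_r>0$, and let $(\boldsymbol\varphi(t),\mathbf r(t))$, $t\ge 0$, be a solution of the partition dynamics $$\dot\varphi_i=-\kappa_\varphi\Big[(2m_i-m_{i-1}-m_{i+1})\frac{\partial m_i}{\partial\varphi_i}+(2m_{i-1}-m_{i-2}-m_i)\frac{\partial m_{i-1}}{\partial\varphi_i}\Big],$$ $$\dot{\mathbf r}_i=-\kappa_r\Big[(2m_i-m_{i-1}-m_{i+1})\nabla_{\mathbf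 r_i}m_i+(2\mathbf r_i-\mathbf r_{i-1}-\mathbf r_{i+1})\Big].$$ Assume that at every time $t\ge0$ each $m_i$ is differentiable as a function of $(\varphi_i,\varphi_{i+1},\mathbf r_i)$ at the current state, and that the reference points stay, for all $t\ge 0$, in some compact subset of the interior of $\Omega$. Then $(\mathbf m(t),\mathbf r(t))$ converges into the set $$\mathcal M=\{(\mathbf m,\mathbf r)\in\mathbb R^N\times(\mathbb R^2)^N \mid m_i=m_j,\ \mathbf r_i=\mathbf r_j\ \text{ for all } i,j\},$$ that is, the distance of $(\mathbf m(t),\mathbf r(t))$ to $\mathcal M$ tends to $0$ as $t\to\infty$. -/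

import Mathlib

open scoped Gradient

noncomputable section

namespace RotaryCoverage

/-- The Euclidean plane. -/
abbrev Plane : Type := EuclideanSpace ℝ (Fin 2)

/-- The unit direction vector with phase angle `θ`. -/
def dir (θ : ℝ) : Plane := !₂[Real.cos θ, Real.sin θ]

/-- The counterclockwise angle from the direction `dir α` to the direction `dir β`,
a number in `[0, 2π)`.  It depends on `α` and `β` only modulo `2π`. -/
def ccwAngle (α β : ℝ) : ℝ := toIcoMod Real.two_pi_pos 0 (β - α)

/-- The closed angular sector with apex `p` that is swept out by a ray rotating counterclockwise
about `p` from the phase angle `α` to the phase angle `β`. -/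
def sector (α β : ℝ) (p : Plane) : Set Plane :=
  {q | ∃ c : ℝ, 0 ≤ c ∧ ∃ θ ∈ Set.Icc α (α + ccwAngle α β), q = p + c • dir θ}

/-- The subregion of `Ω` seen from the reference point `p` between the pointers with phase angles
`α` and `β`. -/
def subregion (Ω : Set Plane) (α β : ℝ) (p : Plane) : Set Plane := Ω ∩ sector α β p

/-- The workload of that subregion, for the event density `ρ`. -/
def workload (Ω : Set Plane) (ρ : Plane → ℝ) (α β : ℝ) (p : Plane) : ℝ :=
  ∫ q in subregion Ω α β p, ρ q

/-- The workload of agent `i` at the phase angles `φ` and reference points `r`.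
Indices are cyclic: the addition of `Fin N` is addition modulo `N`. -/
def agentWorkload {N : ℕ} [NeZero N] (Ω : Set Plane) (ρ : Plane → ℝ)
    (φ : Fin N → ℝ) (r : Fin N → Plane) (i : Fin N) : ℝ :=
  workload Ω ρ (φ i) (φ (i + 1)) (r i)

/-- The difference `2 mᵢ - mᵢ₋₁ - mᵢ₊₁` of the workloads. -/
def workloadDiff {N : ℕ} [NeZero N] (Ω : Set Plane) (ρ : Plane → ℝ)
    (φ : Fin N → ℝ) (r : Fin N → Plane) (i : Fin N) : ℝ :=
  2 * agentWorkload Ω ρ φ r i - agentWorkload Ω ρ φ r (i - 1) - agentWorkload Ω ρ φ r (i + 1)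

/-- Right-hand side of the equation for the phase angle of agent `i`:
`-κ [(2 mᵢ - mᵢ₋₁ - mᵢ₊₁) ∂mᵢ/∂φᵢ + (2 mᵢ₋₁ - mᵢ₋₂ - mᵢ) ∂mᵢ₋₁/∂φᵢ]`. -/
def angleField {N : ℕ} [NeZero N] (Ω : Set Plane) (ρ : Plane → ℝ) (κ : ℝ)
    (φ : Fin N → ℝ) (r : Fin N → Plane) (i : Fin N) : ℝ :=
  -κ * (workloadDiff Ω ρ φ r i *
          deriv (fun a => workload Ω ρ a (φ (i + 1)) (r i)) (φ i) +
        (2 * agentWorkload Ω ρ φ r (i - 1) - agentWorkload Ω ρ φ r (i - 2) -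
            agentWorkload Ω ρ φ r i) *
          deriv (fun b => workload Ω ρ (φ (i - 1)) b (r (i - 1))) (φ i))

/-- Right-hand side of the equation for the reference point of agent `i`:
`-κ [(2 mᵢ - mᵢ₋₁ - mᵢ₊₁) ∂mᵢ/∂rᵢ + (2 rᵢ - rᵢ₋₁ - rᵢ₊₁)]`. -/
def pointField {N : ℕ} [NeZero N] (Ω : Set Plane) (ρ : Plane → ℝ) (κ : ℝ)
    (φ : Fin N → ℝ) (r : Fin N → Plane) (i : Fin N) : Plane :=
  (-κ) • (workloadDiff Ω ρ φ r i •
            (∇ (fun p => workload Ω ρ (φ i) (φ (i + 1)) p) (r i)) +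
          ((2 : ℝ) • r i - r (i - 1) - r (i + 1)))

/-- `(φ, r)` solves the partition dynamics on the time interval `[0, ∞)`.  The phase angles are
followed continuously in `ℝ`; the right-hand sides depend on them only modulo `2π`. -/
structure SolvesPartitionDynamics {N : ℕ} [NeZero N] (Ω : Set Plane) (ρ : Plane → ℝ)
    (κφ κr : ℝ) (φ : ℝ → Fin N → ℝ) (r : ℝ → Fin N → Plane) : Prop where
  angle : ∀ t : ℝ, 0 ≤ t → ∀ i : Fin N,
    HasDerivWithinAt (fun s => φ s i) (angleField Ω ρ κφ (φ t) (r t) i) (Set.Ici 0) t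
  point : ∀ t : ℝ, 0 ≤ t → ∀ i : Fin N,
    HasDerivWithinAt (fun s => r s i) (pointField Ω ρ κr (φ t) (r t) i) (Set.Ici 0) t

/-- The set of pairs `(m, r)` with equal workloads and coinciding reference points. -/
def consensusSet (N : ℕ) : Set ((Fin N → ℝ) × (Fin N → Plane)) :=
  {x | ∀ i j : Fin N, x.1 i = x.1 j ∧ x.2 i = x.2 j}

end RotaryCoverage

end

namespace RotaryCoverage

open MeasureTheory Set Filter Topology

/-! The Lyapunov function is V = ½ Σ|mᵢ - mᵢ₊₁|² + ½ Σ‖rᵢ - rᵢ₊₁‖². The dynamics is its gradient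
flow with separate rates for angles and points (`hasDerivWithinAt_total_disagreement`): with D the
cycle Laplacian of m, aᵢ = -∂mᵢ/∂φᵢ, bᵢ = ∂mᵢ/∂φᵢ₊₁ and gᵢ = ∇mᵢ, one has V' = -κφ Σ(Dᵢaᵢ -
Dᵢ₋₁bᵢ₋₁)² - κr Σ‖Dᵢgᵢ + (Lr)ᵢ‖².

Since the apexes stay in a compact subset of the interior, thin sectors at them carry mass
comparable to their opening, so aᵢ and bᵢ lie in a fixed interval [c, C] with c > 0; comparing
sectors with nearby apexes gives ‖gᵢ‖ ≤ G. As D sums to zero, the first sum is at least k ΣDᵢ²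
(`exists_cycle_coercive`). The second controls Lr up to an error G² ΣDᵢ², which a fraction of the
first absorbs (`exists_decay_rate`). A Poincaré inequality on the cycle (`disagreement_le`) bounds V
by the squared Laplacians. Hence V' ≤ -l V with l > 0 fixed: V decays exponentially, with no
invariance principle, and it dominates the squared distance to consensus up to a constant. -/

/-! ### Polar coordinates and rotated frames. -/

/-- The coordinate of `v` along the direction `dir θ`. -/
noncomputable def along (θ : ℝ) (v : Plane) : ℝ := Real.cos θ * v 0 + Real.sin θ * v 1

/-- The coordinate of `v` along the direction `dir (θ + π / 2)`. -/
noncomputable def across (θ : ℝ) (v : Plane) : ℝ := Real.cos θ * v 1 - Real.sin θ * v 0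

@[simp] lemma dir_zero (θ : ℝ) : dir θ 0 = Real.cos θ := rfl

@[simp] lemma dir_one (θ : ℝ) : dir θ 1 = Real.sin θ := rfl

lemma along_sub (θ : ℝ) (v w : Plane) : along θ (v - w) = along θ v - along θ w := by
  simp only [along, PiLp.sub_apply]; ring

lemma across_sub (θ : ℝ) (v w : Plane) : across θ (v - w) = across θ v - across θ w := by
  simp only [across, PiLp.sub_apply]; ring

lemma along_smul_dir (θ c ψ : ℝ) : along θ (c • dir ψ) = c * Real.cos (ψ - θ) := by
  simp only [along, PiLp.smul_apply, smul_eq_mul, dir_zero, dir_one, Real.cos_sub]; ring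

lemma across_smul_dir (θ c ψ : ℝ) : across θ (c • dir ψ) = c * Real.sin (ψ - θ) := by
  simp only [across, PiLp.smul_apply, smul_eq_mul, dir_zero, dir_one, Real.sin_sub]; ring

lemma along_sq_add_across_sq (θ : ℝ) (v : Plane) :
    along θ v ^ 2 + across θ v ^ 2 = ‖v‖ ^ 2 := by
  rw [EuclideanSpace.norm_sq_eq, Fin.sum_univ_two]
  simp only [along, across, Real.norm_eq_abs, sq_abs]
  linear_combination (v 0 ^ 2 + v 1 ^ 2) * Real.sin_sq_add_cos_sq θ

lemma abs_along_le (θ : ℝ) (v : Plane) : |along θ v| ≤ ‖v‖ :=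
  abs_le_of_sq_le_sq (by nlinarith [along_sq_add_across_sq θ v, sq_nonneg (across θ v)])
    (norm_nonneg v)

lemma abs_across_le (θ : ℝ) (v : Plane) : |across θ v| ≤ ‖v‖ :=
  abs_le_of_sq_le_sq (by nlinarith [along_sq_add_across_sq θ v, sq_nonneg (along θ v)])
    (norm_nonneg v)

lemma norm_smul_dir {c : ℝ} (hc : 0 ≤ c) (θ : ℝ) : ‖c • dir θ‖ = c := by
  have h := along_sq_add_across_sq θ (c • dir θ)
  rw [along_smul_dir, across_smul_dir, sub_self, Real.cos_zero, Real.sin_zero] at h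
  have h' : ‖c • dir θ‖ ^ 2 = c ^ 2 := by linarith
  exact (pow_left_inj₀ (norm_nonneg _) hc two_ne_zero).1 h'

lemma dir_add_int_mul_two_pi (θ : ℝ) (k : ℤ) : dir (θ + k * (2 * Real.pi)) = dir θ := by
  simp [dir]

lemma exists_polar (v : Plane) : ∃ c : ℝ, 0 ≤ c ∧ ∃ θ : ℝ, v = c • dir θ := by
  refine ⟨‖(⟨v 0, v 1⟩ : ℂ)‖, norm_nonneg _, Complex.arg ⟨v 0, v 1⟩, ?_⟩
  ext i
  fin_cases i
  · simp [Complex.norm_mul_cos_arg]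
  · simp [Complex.norm_mul_sin_arg]

lemma exists_polar_Ico (v : Plane) (a : ℝ) :
    ∃ c : ℝ, 0 ≤ c ∧ ∃ θ ∈ Ico a (a + 2 * Real.pi), v = c • dir θ := by
  obtain ⟨c, hc, θ, rfl⟩ := exists_polar v
  obtain ⟨hmem, z, hz⟩ := (toIcoMod_eq_iff Real.two_pi_pos (a := a) (b := θ)).1 rfl
  refine ⟨c, hc, _, hmem, ?_⟩
  conv_lhs => rw [hz]
  rw [zsmul_eq_mul, dir_add_int_mul_two_pi]

lemma eq_of_smul_dir_eq {c c' θ θ' : ℝ} (hc : 0 < c) (hc' : 0 ≤ c')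
    (h : c • dir θ = c' • dir θ') (hθ : |θ - θ'| < 2 * Real.pi) : θ = θ' := by
  have hcc : c = c' := by rw [← norm_smul_dir hc.le θ, h, norm_smul_dir hc']
  subst hcc
  have h1 := congrArg (along θ') h
  rw [along_smul_dir, along_smul_dir, sub_self, Real.cos_zero] at h1
  have h2 : Real.cos (θ - θ') = 1 := mul_left_cancel₀ hc.ne' h1
  rw [abs_lt] at hθ
  have := (Real.cos_eq_one_iff_of_lt_of_lt hθ.1 hθ.2).1 h2
  linarith

lemma inner_dir_left (θ : ℝ) (v : Plane) : inner ℝ (dir θ) v = along θ v := by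
  simp only [EuclideanSpace.inner_eq_star_dotProduct, dotProduct, Fin.sum_univ_two, along,
    Pi.star_apply, star_trivial, dir_zero, dir_one]
  ring

lemma along_dir (θ ψ : ℝ) : along θ (dir ψ) = Real.cos (ψ - θ) := by
  simpa using along_smul_dir θ 1 ψ

/-- Every pair of perpendicular axes of the plane comes from an orthonormal basis. -/
lemma exists_frame (θ : ℝ) : ∃ b : OrthonormalBasis (Fin 2) ℝ Plane,
    ∀ v, b.repr v 0 = along θ v ∧ b.repr v 1 = across θ v := by
  have hn : Orthonormal ℝ ![dir θ, dir (θ + Real.pi / 2)] := by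
    rw [orthonormal_iff_ite]
    intro i j
    fin_cases i <;> fin_cases j <;> simp [-inner_self_eq_norm_sq_to_K, inner_dir_left, along_dir]
  have hn' : Orthonormal ℝ ((univ : Set (Fin 2)).domRestrict ![dir θ, dir (θ + Real.pi / 2)]) :=
    hn.comp _ Subtype.val_injective
  obtain ⟨b, hb⟩ := hn'.exists_orthonormalBasis_extension_of_card_eq (by simp)
  refine ⟨b, fun v => ?_⟩
  rw [b.repr_apply_apply, b.repr_apply_apply, hb 0 trivial, hb 1 trivial]
  refine ⟨inner_dir_left θ v, (inner_dir_left _ v).trans ?_⟩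
  simp only [along, across, Real.cos_add_pi_div_two, Real.sin_add_pi_div_two]
  ring

/-- Coordinates in an orthonormal frame preserve volume, so the box is the preimage of a product of
intervals of the same size. -/
lemma volume_box (θ : ℝ) (p : Plane) (a b c d : ℝ) :
    volume {q : Plane | along θ (q - p) ∈ Icc a b ∧ across θ (q - p) ∈ Icc c d} =
      ENNReal.ofReal (b - a) * ENNReal.ofReal (d - c) := by
  obtain ⟨e, he⟩ := exists_frame θ
  have hmp := (PiLp.volume_preserving_ofLp (Fin 2)).comp e.measurePreserving_repr
  have hset : {q : Plane | along θ (q - p) ∈ Icc a b ∧ across θ (q - p) ∈ Icc c d} =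
      (WithLp.ofLp ∘ e.repr) ⁻¹'
        (Set.pi univ ![Icc (along θ p + a) (along θ p + b), Icc (across θ p + c) (across θ p + d)])
      := by
    ext q
    simp only [mem_ofPred_eq, mem_preimage, mem_univ_pi, Fin.forall_fin_two, Function.comp_apply,
      Matrix.cons_val_zero, Matrix.cons_val_one, (he q).1, (he q).2, along_sub, across_sub, mem_Icc,
      le_sub_iff_add_le', sub_le_iff_le_add']
  have hbox : MeasurableSet (Set.pi univ
      ![Icc (along θ p + a) (along θ p + b), Icc (across θ p + c) (across θ p + d)]) :=
    MeasurableSet.univ_pi (Fin.forall_fin_two.2 ⟨measurableSet_Icc, measurableSet_Icc⟩)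
  rw [hset, hmp.measure_preimage hbox.nullMeasurableSet, volume_pi_pi, Fin.prod_univ_two]
  simp

/-! ### Geometry of wedges. -/

/-- The closed region swept by a ray with apex `p` that rotates from the angle `a` to the
angle `b`. -/
def wedge (a b : ℝ) (p : Plane) : Set Plane :=
  {q | ∃ c : ℝ, 0 ≤ c ∧ ∃ θ ∈ Icc a b, q = p + c • dir θ}

lemma sector_eq_wedge (α β : ℝ) (p : Plane) : sector α β p = wedge α (α + ccwAngle α β) p := rfl

lemma measurableSet_wedge (a b : ℝ) (p : Plane) : MeasurableSet (wedge a b p) := by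
  have h : wedge a b p = ⋃ n : ℕ, (fun x : ℝ × ℝ => p + x.1 • dir x.2) '' (Icc 0 (n : ℝ) ×ˢ Icc a b)
      := by
    ext q
    simp only [wedge, mem_ofPred_eq, mem_iUnion, mem_image, mem_prod, Prod.exists]
    constructor
    · rintro ⟨c, hc, θ, hθ, rfl⟩
      obtain ⟨n, hn⟩ := exists_nat_ge c
      exact ⟨n, c, θ, ⟨⟨hc, hn⟩, hθ⟩, rfl⟩
    · rintro ⟨n, c, θ, ⟨⟨hc, hn⟩, hθ⟩, rfl⟩
      exact ⟨c, hc, θ, hθ, rfl⟩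
  have hdir : Continuous dir := by
    unfold dir
    refine (PiLp.continuous_toLp 2 _).comp (continuous_pi (Fin.forall_fin_two.2 ⟨?_, ?_⟩))
    · exact Real.continuous_cos
    · exact Real.continuous_sin
  rw [h]
  refine MeasurableSet.iUnion fun n => IsCompact.measurableSet ?_
  refine (isCompact_Icc.prod isCompact_Icc).image ?_
  exact continuous_const.add (continuous_fst.smul (hdir.comp continuous_snd))

lemma wedge_union {a b c : ℝ} (hab : a ≤ b) (hbc : b ≤ c) (p : Plane) :
    wedge a b p ∪ wedge b c p = wedge a c p := by
  ext q
  simp only [wedge, mem_union, mem_ofPred_eq]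
  constructor
  · rintro (⟨s, hs, θ, hθ, h⟩ | ⟨s, hs, θ, hθ, h⟩)
    · exact ⟨s, hs, θ, ⟨hθ.1, hθ.2.trans hbc⟩, h⟩
    · exact ⟨s, hs, θ, ⟨hab.trans hθ.1, hθ.2⟩, h⟩
  · rintro ⟨s, hs, θ, hθ, h⟩
    rcases le_total θ b with h' | h'
    · exact Or.inl ⟨s, hs, θ, ⟨hθ.1, h'⟩, h⟩
    · exact Or.inr ⟨s, hs, θ, ⟨h', hθ.2⟩, h⟩

/-- The total opening is below a full turn, so away from the apex the polar angle is unique and a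
common point must have angle b. -/
lemma across_eq_zero_of_mem_wedge_inter {a b c : ℝ} (hac : c < a + 2 * Real.pi) {p q : Plane}
    (h1 : q ∈ wedge a b p) (h2 : q ∈ wedge b c p) : across b (q - p) = 0 := by
  obtain ⟨s, hs, θ, hθ, rfl⟩ := h1
  obtain ⟨s', hs', θ', hθ', h⟩ := h2
  rw [add_sub_cancel_left, across_smul_dir]
  rcases hs.eq_or_lt with rfl | hs0
  · simp
  have := eq_of_smul_dir_eq hs0 hs' (add_left_cancel h) (by
    rw [abs_lt]
    constructor <;> linarith [hθ.1, hθ.2, hθ'.1, hθ'.2, Real.pi_pos])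
  have hb : θ = b := le_antisymm hθ.2 (this ▸ hθ'.1)
  simp [hb]

lemma abs_across_le_of_mem_wedge {b h : ℝ} {p q : Plane}
    (hq : q ∈ wedge b (b + h) p) : |across b (q - p)| ≤ ‖q - p‖ * h := by
  obtain ⟨s, hs, θ, hθ, rfl⟩ := hq
  rw [add_sub_cancel_left, across_smul_dir, norm_smul_dir hs, abs_mul, abs_of_nonneg hs]
  gcongr
  refine (Real.abs_sin_le_abs).trans ?_
  rw [abs_of_nonneg (by linarith [hθ.1])]
  linarith [hθ.2]

/-- Since θ ≤ tan θ on [0, π/2), a slope of at most h forces an angle of at most h. -/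
lemma mem_wedge_of_coord {b h : ℝ} {p q : Plane} (hx : 0 < along b (q - p))
    (hy : 0 ≤ across b (q - p)) (hxy : across b (q - p) ≤ along b (q - p) * h) :
    q ∈ wedge b (b + h) p := by
  obtain ⟨c, hc, θ, hθ, hq⟩ := exists_polar_Ico (q - p) (b - Real.pi)
  rw [hq, along_smul_dir] at hx
  rw [hq, across_smul_dir] at hy
  rw [hq, across_smul_dir, along_smul_dir] at hxy
  have hc0 : 0 < c := hc.lt_of_ne (by rintro rfl; simp at hx)
  have hcos : 0 < Real.cos (θ - b) := pos_of_mul_pos_right hx hc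
  have hsin : 0 ≤ Real.sin (θ - b) := nonneg_of_mul_nonneg_right hy hc0
  have h0 : 0 ≤ θ - b := by
    by_contra! hneg
    rcases eq_or_lt_of_le (show -Real.pi ≤ θ - b by linarith [hθ.1]) with h1 | h1
    · rw [← h1, Real.cos_neg, Real.cos_pi] at hcos
      linarith
    · linarith [Real.sin_neg_of_neg_of_neg_pi_lt hneg h1]
  have h1 : θ - b < Real.pi / 2 := by
    by_contra! hge
    linarith [Real.cos_nonpos_of_pi_div_two_le_of_le hge (by linarith [hθ.2, Real.pi_pos])]
  have h2 : θ - b ≤ h := by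
    refine (Real.le_tan h0 h1).trans ?_
    rw [Real.tan_eq_sin_div_cos, div_le_iff₀ hcos]
    refine le_of_mul_le_mul_left ?_ hc0
    linarith
  exact ⟨c, hc, θ, ⟨by linarith, by linarith⟩, by rw [← hq]; abel⟩

/-- A point that changes membership when the apex of a sector is moved is close to one of the two
lines that bound the sector. -/
lemma abs_across_le_of_mem_wedge_of_notMem {a w : ℝ} {p p' q : Plane}
    (h : q ∈ wedge a (a + w) p) (h' : q ∉ wedge a (a + w) p') :
    |across a (q - p)| ≤ ‖p' - p‖ ∨ |across (a + w) (q - p)| ≤ ‖p' - p‖ := by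
  by_contra! hcon
  obtain ⟨c, hc, θ, hθ, rfl⟩ := h
  rw [add_sub_cancel_left] at hcon
  obtain ⟨c', hc', θ', hθ', hq⟩ := exists_polar_Ico (p + c • dir θ - p') a
  have hθ'' : a + w < θ' := by
    by_contra! hle
    exact h' ⟨c', hc', θ', ⟨hθ'.1, hle⟩, by rw [← hq]; abel⟩
  -- Moving the apex by less than the distance from q to a boundary line leaves q on the same side
  -- of it, so the two sines have the same sign.
  have key : ∀ ψ, ‖p' - p‖ < |across ψ (c • dir θ)| →
      0 < Real.sin (θ - ψ) * Real.sin (θ' - ψ) := by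
    intro ψ hψ
    have h1 : across ψ (c' • dir θ') = across ψ (c • dir θ) - across ψ (p' - p) := by
      rw [← across_sub, ← hq]; congr 1; abel
    have h2 := (abs_across_le ψ (p' - p)).trans_lt hψ
    have h3 : 0 < across ψ (c • dir θ) * across ψ (c' • dir θ') := by
      rw [h1]
      rcases lt_abs.1 h2 with h3 | h3
      · have := abs_lt.1 h2
        have h4 : 0 < across ψ (c • dir θ) := (abs_nonneg _).trans_lt h3
        exact mul_pos h4 (by linarith [le_abs_self (across ψ (p' - p))])
      · have h4 : across ψ (c • dir θ) < 0 := by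
          linarith [abs_nonneg (across ψ (p' - p))]
        exact mul_pos_of_neg_of_neg h4 (by linarith [neg_abs_le (across ψ (p' - p))])
    rw [across_smul_dir, across_smul_dir] at h3
    by_contra! h5
    nlinarith [mul_nonneg hc hc']
  have ha := key a hcon.1
  have hb := key (a + w) hcon.2
  have hx : θ - (a + w) ≤ 0 := by linarith [hθ.2]
  have hθ1 := hθ.1
  have hθ2 := hθ'.2
  -- The line at angle a puts θ and θ' in the same half turn. Since θ ≤ a + w < θ', the other
  -- boundary line then separates them, against `hb`.
  rcases lt_or_ge 0 (Real.sin (θ - a)) with hs | hs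
  · have h1 : 0 < Real.sin (θ' - a) := (pos_iff_pos_of_mul_pos ha).1 hs
    have h2 : θ' - a < Real.pi := by
      by_contra! hge
      have := Real.sin_nonpos_of_nonpos_of_neg_pi_le (x := θ' - a - 2 * Real.pi)
        (by linarith) (by linarith)
      rw [Real.sin_sub_two_pi] at this
      linarith
    have h3 : 0 < Real.sin (θ' - (a + w)) :=
      Real.sin_pos_of_pos_of_lt_pi (by linarith) (by linarith [hθ.2])
    have h4 := Real.sin_nonpos_of_nonpos_of_neg_pi_le hx (by linarith [hθ.2])
    nlinarith
  · have h1 : Real.pi < θ - a := by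
      by_contra! hle
      have := Real.sin_nonneg_of_nonneg_of_le_pi (by linarith : 0 ≤ θ - a) hle
      rw [le_antisymm hs this, zero_mul] at ha
      exact lt_irrefl _ ha
    have h3 : 0 < Real.sin (θ' - (a + w)) :=
      Real.sin_pos_of_pos_of_lt_pi (by linarith) (by linarith)
    have h4 := Real.sin_nonpos_of_nonpos_of_neg_pi_le hx (by linarith)
    nlinarith

/-! ### Bounds on the workload and its partial derivatives. -/

section Workload

variable {Ω : Set Plane} {ρ : Plane → ℝ} {ρlo ρhi R : ℝ} {p : Plane}

lemma volume_inter_strip_le (hR : ∀ q ∈ Ω, ‖q - p‖ ≤ R) (hR0 : 0 ≤ R) (θ ε : ℝ) :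
    volume (Ω ∩ {q | |across θ (q - p)| ≤ ε}) ≤ ENNReal.ofReal (4 * R * ε) := by
  have h := volume_box θ p (-R) R (-ε) ε
  rw [← ENNReal.ofReal_mul (by linarith)] at h
  rw [show 4 * R * ε = (R - -R) * (ε - -ε) by ring, ← h]
  refine measure_mono ?_
  rintro q ⟨hq, hqε⟩
  exact ⟨abs_le.1 ((abs_along_le θ _).trans (hR q hq)), abs_le.1 hqε⟩

lemma setIntegral_inter_le
    (hlo : 0 < ρlo) (hρb : ∀ q ∈ Ω, ρ q ∈ Icc ρlo ρhi) {S : Set Plane} {v : ℝ} (hv : 0 ≤ v)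
    (hS : volume (Ω ∩ S) ≤ ENNReal.ofReal v) :
    ∫ q in Ω ∩ S, ρ q ≤ |ρhi| * v := by
  have h1 : ‖∫ q in Ω ∩ S, ρ q‖ ≤ |ρhi| * volume.real (Ω ∩ S) := by
    refine norm_setIntegral_le_of_norm_le_const (hS.trans_lt ENNReal.ofReal_lt_top) ?_
    intro q hq
    have := hρb q hq.1
    rw [Real.norm_eq_abs, abs_of_pos (hlo.trans_le this.1)]
    exact this.2.trans (le_abs_self _)
  refine (le_abs_self _).trans (h1.trans ?_)
  gcongr
  exact ENNReal.toReal_le_of_le_ofReal hv hS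

lemma setIntegral_inter_mono (hint : IntegrableOn ρ Ω) (hΩ : MeasurableSet Ω)
    (hlo : 0 < ρlo) (hρb : ∀ q ∈ Ω, ρ q ∈ Icc ρlo ρhi) {S T : Set Plane} (hT : MeasurableSet T)
    (hST : Ω ∩ S ⊆ Ω ∩ T) : ∫ q in Ω ∩ S, ρ q ≤ ∫ q in Ω ∩ T, ρ q := by
  refine setIntegral_mono_set (hint.mono_set inter_subset_left) ?_ hST.eventuallyLE
  filter_upwards [ae_restrict_mem (hΩ.inter hT)] with q hq
  exact hlo.le.trans (hρb q hq.1).1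

lemma le_setIntegral_wedge (hint : IntegrableOn ρ Ω) (hΩ : MeasurableSet Ω)
    (hlo : 0 < ρlo) (hρb : ∀ q ∈ Ω, ρ q ∈ Icc ρlo ρhi) {δ : ℝ} (hδ : 0 < δ)
    (hball : Metric.ball p δ ⊆ Ω) (b : ℝ) {h : ℝ} (h0 : 0 ≤ h) (h1 : h ≤ 1) :
    ρlo * (δ ^ 2 / 16) * h ≤ ∫ q in Ω ∩ wedge b (b + h) p, ρ q := by
  -- This box has area (δ²/16)h. It lies in the wedge because y ≤ (δ/4)h ≤ xh, and in the ball
  -- because h ≤ 1.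
  set B : Set Plane := {q | along b (q - p) ∈ Icc (δ / 4) (δ / 2) ∧
    across b (q - p) ∈ Icc 0 (δ / 4 * h)} with hB
  have hvol : volume.real B = δ ^ 2 / 16 * h := by
    rw [measureReal_def, hB, volume_box, ENNReal.toReal_mul, ENNReal.toReal_ofReal (by linarith),
      ENNReal.toReal_ofReal (by rw [sub_zero]; positivity)]
    ring
  have hBfin : volume B ≠ ⊤ := by
    rw [hB, volume_box]
    exact ENNReal.mul_ne_top ENNReal.ofReal_ne_top ENNReal.ofReal_ne_top
  have hsub : B ⊆ Ω ∩ wedge b (b + h) p := by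
    rintro q ⟨hx, hy⟩
    refine ⟨hball ?_, mem_wedge_of_coord (by linarith [hx.1]) hy.1 (hy.2.trans ?_)⟩
    · rw [Metric.mem_ball, dist_eq_norm]
      refine lt_of_pow_lt_pow_left₀ 2 hδ.le ?_
      rw [← along_sq_add_across_sq b]
      have hy' : across b (q - p) ≤ δ / 4 := hy.2.trans (by nlinarith)
      nlinarith [hx.1, hx.2, hy.1, hy.2]
    · exact mul_le_mul_of_nonneg_right hx.1 h0
  have hBm : MeasurableSet B := by
    have hc1 : Measurable fun q : Plane => along b (q - p) := by
      unfold along; fun_prop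
    have hc2 : Measurable fun q : Plane => across b (q - p) := by
      unfold across; fun_prop
    exact (hc1 measurableSet_Icc).inter (hc2 measurableSet_Icc)
  have hBint : IntegrableOn ρ B := hint.mono_set (hsub.trans inter_subset_left)
  have h2 : ρlo * volume.real B ≤ ∫ q in B, ρ q :=
    setIntegral_ge_of_const_le_real hBm hBfin (fun q hq => (hρb q (hsub hq).1).1) hBint
  have h3 := setIntegral_inter_mono (S := B) hint hΩ hlo hρb (measurableSet_wedge b (b + h) p)
    (fun q hq => hsub hq.2)
  rw [inter_eq_self_of_subset_right (hsub.trans inter_subset_left)] at h3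
  rw [hvol] at h2
  linarith

lemma setIntegral_wedge_le (hlo : 0 < ρlo) (hρb : ∀ q ∈ Ω, ρ q ∈ Icc ρlo ρhi) (hR : ∀ q ∈ Ω, ‖q - p‖ ≤ R) (hR0 : 0 ≤ R)
    (b : ℝ) {h : ℝ} (h0 : 0 ≤ h) :
    ∫ q in Ω ∩ wedge b (b + h) p, ρ q ≤ |ρhi| * (4 * R ^ 2) * h := by
  have hv : volume (Ω ∩ wedge b (b + h) p) ≤ ENNReal.ofReal (4 * R * (R * h)) := by
    refine (measure_mono ?_).trans (volume_inter_strip_le hR hR0 b _)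
    rintro q ⟨hq, hw⟩
    refine ⟨hq, (abs_across_le_of_mem_wedge hw).trans ?_⟩
    exact mul_le_mul_of_nonneg_right (hR q hq) h0
  have := setIntegral_inter_le hlo hρb (by positivity) hv
  linarith

/-- The two wedges overlap within a single line, which is null. -/
lemma setIntegral_wedge_add (hint : IntegrableOn ρ Ω) (hΩ : MeasurableSet Ω)
    (hR : ∀ q ∈ Ω, ‖q - p‖ ≤ R) (hR0 : 0 ≤ R) {a b c : ℝ} (hab : a ≤ b) (hbc : b ≤ c)
    (hac : c < a + 2 * Real.pi) :
    ∫ q in Ω ∩ wedge a c p, ρ q =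
      (∫ q in Ω ∩ wedge a b p, ρ q) + ∫ q in Ω ∩ wedge b c p, ρ q := by
  rw [← wedge_union hab hbc, inter_union_distrib_left]
  refine setIntegral_union₀ ?_ (hΩ.inter (measurableSet_wedge b c p)).nullMeasurableSet
    (hint.mono_set inter_subset_left) (hint.mono_set inter_subset_left)
  refine nonpos_iff_eq_zero.1 ((measure_mono ?_).trans
    ((volume_inter_strip_le hR hR0 b 0).trans (by simp)))
  rintro q ⟨⟨hq, h1⟩, -, h2⟩
  exact ⟨hq, by simp [across_eq_zero_of_mem_wedge_inter hac h1 h2]⟩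

lemma ccwAngle_nonneg (α β : ℝ) : 0 ≤ ccwAngle α β := left_le_toIcoMod _ _ _

lemma ccwAngle_lt_two_pi (α β : ℝ) : ccwAngle α β < 2 * Real.pi :=
  (toIcoMod_lt_right Real.two_pi_pos 0 (β - α)).trans_eq (zero_add _)

/-- Only widening is considered: `ccwAngle` may be 0, and narrowing such a sector would wrap it to
almost a full turn, whereas a small widening never wraps. -/
lemma ccwAngle_eq_add {α β α' β' h : ℝ} (hh : β' - α' = β - α + h) (h0 : 0 ≤ h)
    (h1 : ccwAngle α β + h < 2 * Real.pi) : ccwAngle α' β' = ccwAngle α β + h := by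
  obtain ⟨-, z, hz⟩ := (toIcoMod_eq_iff Real.two_pi_pos (a := 0) (b := β - α)).1 rfl
  refine (toIcoMod_eq_iff Real.two_pi_pos).2
    ⟨⟨by linarith [ccwAngle_nonneg α β], by linarith⟩, z, ?_⟩
  rw [hh, ccwAngle]
  conv_lhs => rw [hz]
  ring

lemma workload_add_right (hint : IntegrableOn ρ Ω) (hΩ : MeasurableSet Ω)
    (hR : ∀ q ∈ Ω, ‖q - p‖ ≤ R) (hR0 : 0 ≤ R) {α β h : ℝ} (h0 : 0 ≤ h)
    (h1 : ccwAngle α β + h < 2 * Real.pi) :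
    workload Ω ρ α (β + h) p = workload Ω ρ α β p +
      ∫ q in Ω ∩ wedge (α + ccwAngle α β) (α + ccwAngle α β + h) p, ρ q := by
  simp only [workload, subregion, sector_eq_wedge]
  rw [ccwAngle_eq_add (α := α) (β := β) (by ring) h0 h1, ← add_assoc]
  exact setIntegral_wedge_add hint hΩ hR hR0 (by linarith [ccwAngle_nonneg α β]) (by linarith)
    (by linarith)

lemma workload_sub_left (hint : IntegrableOn ρ Ω) (hΩ : MeasurableSet Ω)
    (hR : ∀ q ∈ Ω, ‖q - p‖ ≤ R) (hR0 : 0 ≤ R) {α β h : ℝ} (h0 : 0 ≤ h)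
    (h1 : ccwAngle α β + h < 2 * Real.pi) :
    workload Ω ρ (α - h) β p = workload Ω ρ α β p +
      ∫ q in Ω ∩ wedge (α - h) (α - h + h) p, ρ q := by
  simp only [workload, subregion, sector_eq_wedge]
  rw [ccwAngle_eq_add (α := α) (β := β) (by ring) h0 h1,
    show α - h + (ccwAngle α β + h) = α + ccwAngle α β by ring, sub_add_cancel]
  exact (setIntegral_wedge_add hint hΩ hR hR0 (by linarith)
    (by linarith [ccwAngle_nonneg α β]) (by linarith)).trans (add_comm _ _)

/-- The regions differ only in two strips along the boundary lines, each of width proportional to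
the displacement. -/
lemma abs_workload_sub_le (hint : IntegrableOn ρ Ω) (hΩ : MeasurableSet Ω)
    (hlo : 0 < ρlo) (hρb : ∀ q ∈ Ω, ρ q ∈ Icc ρlo ρhi)
    (hR : ∀ q ∈ Ω, ∀ q' ∈ Ω, ‖q - q'‖ ≤ R) (hR0 : 0 ≤ R) (α β : ℝ) {p' : Plane}
    (hp : p ∈ Ω) (hp' : p' ∈ Ω) :
    |workload Ω ρ α β p' - workload Ω ρ α β p| ≤ |ρhi| * (8 * R) * ‖p' - p‖ := by
  have key : ∀ x ∈ Ω, ∀ y ∈ Ω,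
      workload Ω ρ α β x - workload Ω ρ α β y ≤ |ρhi| * (8 * R) * ‖y - x‖ := by
    intro x hx y hy
    simp only [workload, subregion, sector_eq_wedge]
    set X := wedge α (α + ccwAngle α β) x
    set Y := wedge α (α + ccwAngle α β) y
    have hX : MeasurableSet X := measurableSet_wedge _ _ _
    have hY : MeasurableSet Y := measurableSet_wedge _ _ _
    have hvol : volume (Ω ∩ (X \ Y)) ≤ ENNReal.ofReal (8 * R * ‖y - x‖) := by
      have hstrip := fun θ => volume_inter_strip_le (fun q hq => hR q hq x hx) hR0 θ
        ‖y - x‖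
      rw [show 8 * R * ‖y - x‖ = 4 * R * ‖y - x‖ + 4 * R * ‖y - x‖ by ring,
        ENNReal.ofReal_add (by positivity) (by positivity)]
      refine (measure_mono ?_).trans ((measure_union_le _ _).trans
        (add_le_add (hstrip α) (hstrip (α + ccwAngle α β))))
      rintro q ⟨hq, hqX, hqY⟩
      rcases abs_across_le_of_mem_wedge_of_notMem hqX hqY with h | h
      exacts [Or.inl ⟨hq, h⟩, Or.inr ⟨hq, h⟩]
    have h1 := setIntegral_inter_le hlo hρb (by positivity) hvol
    have h2 : ∫ q in Ω ∩ X, ρ q = (∫ q in Ω ∩ (X ∩ Y), ρ q) + ∫ q in Ω ∩ (X \ Y), ρ q := by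
      rw [← setIntegral_union, ← inter_union_distrib_left, inter_union_sdiff]
      · exact disjoint_left.2 fun q h h' => h'.2.2 h.2.2
      · exact hΩ.inter (hX.diff hY)
      · exact hint.mono_set inter_subset_left
      · exact hint.mono_set inter_subset_left
    have h3 := setIntegral_inter_mono (S := X ∩ Y) hint hΩ hlo hρb hY
      (inter_subset_inter_right _ inter_subset_right)
    linarith
  rw [abs_sub_le_iff]
  refine ⟨?_, key p hp p' hp'⟩
  rw [norm_sub_rev]
  exact key p' hp' p hp

/-- As the derivative is already known to exist, slopes from one side determine it; this is why
widening estimates suffice. -/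
lemma mem_Icc_of_hasDerivAt {f : ℝ → ℝ} {f' x c C : ℝ} (hf : HasDerivAt f f' x)
    (h : ∀ᶠ t in 𝓝[>] (0 : ℝ), f (x + t) - f x ∈ Icc (c * t) (C * t)) : f' ∈ Icc c C := by
  have hs := hf.tendsto_slope_zero_right
  constructor
  · refine ge_of_tendsto hs ?_
    filter_upwards [h, self_mem_nhdsWithin] with t ht ht0
    rw [smul_eq_mul, ← div_eq_inv_mul, le_div_iff₀ ht0]
    exact ht.1
  · refine le_of_tendsto hs ?_
    filter_upwards [h, self_mem_nhdsWithin] with t ht ht0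
    rw [smul_eq_mul, ← div_eq_inv_mul, div_le_iff₀ ht0]
    exact ht.2

lemma eventually_ccwAngle_add (α β : ℝ) : ∀ᶠ t in 𝓝[>] (0 : ℝ),
    0 ≤ t ∧ t ≤ 1 ∧ ccwAngle α β + t < 2 * Real.pi := by
  have h := ccwAngle_lt_two_pi α β
  have h1 : Ioo (0 : ℝ) (min 1 (2 * Real.pi - ccwAngle α β)) ∈ 𝓝[>] (0 : ℝ) :=
    Ioo_mem_nhdsGT (lt_min one_pos (by linarith))
  filter_upwards [h1] with t ht
  have := lt_min_iff.1 ht.2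
  exact ⟨ht.1.le, this.1.le, by linarith⟩

lemma hasDerivAt_workload_right_mem (hint : IntegrableOn ρ Ω) (hΩ : MeasurableSet Ω)
    (hlo : 0 < ρlo) (hρb : ∀ q ∈ Ω, ρ q ∈ Icc ρlo ρhi) (hR : ∀ q ∈ Ω, ‖q - p‖ ≤ R) (hR0 : 0 ≤ R)
    {δ : ℝ} (hδ : 0 < δ) (hball : Metric.ball p δ ⊆ Ω) {α β f' : ℝ}
    (hf : HasDerivAt (fun b => workload Ω ρ α b p) f' β) :
    f' ∈ Icc (ρlo * (δ ^ 2 / 16)) (|ρhi| * (4 * R ^ 2)) := by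
  refine mem_Icc_of_hasDerivAt hf ?_
  filter_upwards [eventually_ccwAngle_add α β] with t ht
  rw [workload_add_right hint hΩ hR hR0 ht.1 ht.2.2, add_sub_cancel_left]
  exact ⟨le_setIntegral_wedge hint hΩ hlo hρb hδ hball _ ht.1 ht.2.1,
    setIntegral_wedge_le hlo hρb hR hR0 _ ht.1⟩

lemma hasDerivAt_workload_left_mem (hint : IntegrableOn ρ Ω) (hΩ : MeasurableSet Ω)
    (hlo : 0 < ρlo) (hρb : ∀ q ∈ Ω, ρ q ∈ Icc ρlo ρhi) (hR : ∀ q ∈ Ω, ‖q - p‖ ≤ R) (hR0 : 0 ≤ R)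
    {δ : ℝ} (hδ : 0 < δ) (hball : Metric.ball p δ ⊆ Ω) {α β f' : ℝ}
    (hf : HasDerivAt (fun a => workload Ω ρ a β p) f' α) :
    -f' ∈ Icc (ρlo * (δ ^ 2 / 16)) (|ρhi| * (4 * R ^ 2)) := by
  -- Reversing the parameter turns a retreat of the first pointer into a widening of the sector.
  have hf' : HasDerivAt (fun t => workload Ω ρ (α - t) β p) (-f') 0 := by
    have h1 : HasDerivAt (fun t : ℝ => α - t) (-1) 0 := by
      simpa using (hasDerivAt_id (0 : ℝ)).const_sub α
    have h2 : HasDerivAt (fun a => workload Ω ρ a β p) f' (α - 0) := by rwa [sub_zero]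
    have h3 := h2.comp (0 : ℝ) h1
    rwa [mul_neg_one] at h3
  refine mem_Icc_of_hasDerivAt hf' ?_
  filter_upwards [eventually_ccwAngle_add α β] with t ht
  rw [zero_add, sub_zero, workload_sub_left hint hΩ hR hR0 ht.1 ht.2.2, add_sub_cancel_left]
  exact ⟨le_setIntegral_wedge hint hΩ hlo hρb hδ hball _ ht.1 ht.2.1,
    setIntegral_wedge_le hlo hρb hR hR0 _ ht.1⟩

lemma norm_gradient_workload_le (hint : IntegrableOn ρ Ω) (hΩ : MeasurableSet Ω)
    (hlo : 0 < ρlo) (hρb : ∀ q ∈ Ω, ρ q ∈ Icc ρlo ρhi)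
    (hR : ∀ q ∈ Ω, ∀ q' ∈ Ω, ‖q - q'‖ ≤ R) (hR0 : 0 ≤ R) (hp : p ∈ interior Ω) {α β : ℝ}
    {g : Plane} (hg : HasGradientAt (fun x => workload Ω ρ α β x) g p) :
    ‖g‖ ≤ |ρhi| * (8 * R) := by
  have h := hg.hasFDerivAt.le_of_lip' (C := |ρhi| * (8 * R)) (by positivity) (by
    filter_upwards [mem_interior_iff_mem_nhds.1 hp] with x hx
    exact abs_workload_sub_le hint hΩ hlo hρb hR hR0 α β (interior_subset hp) hx)
  simpa using h

end Workload

/-! ### Discrete analysis on the cycle graph. -/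

section Cycle

variable {N : ℕ} [NeZero N] {E : Type*} [NormedAddCommGroup E]

/-- The disagreement of the values along the edges of the cycle. -/
noncomputable def disagreement (u : Fin N → E) : ℝ := 1 / 2 * ∑ i, ‖u i - u (i + 1)‖ ^ 2

lemma disagreement_nonneg (u : Fin N → E) : 0 ≤ disagreement u := by
  unfold disagreement; positivity

lemma sum_add_one {M : Type*} [AddCommMonoid M] (f : Fin N → M) : ∑ i, f (i + 1) = ∑ i, f i :=
  Fintype.sum_equiv (Equiv.addRight 1) _ _ fun _ => rfl

lemma sum_sub_one {M : Type*} [AddCommMonoid M] (f : Fin N → M) : ∑ i, f (i - 1) = ∑ i, f i :=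
  Fintype.sum_equiv (Equiv.subRight 1) _ _ fun _ => rfl

lemma ofNat_succ (n : ℕ) : Fin.ofNat N (n + 1) = Fin.ofNat N n + 1 := by
  ext
  simp [Fin.val_add]

lemma sub_two_eq (i : Fin N) : i - 2 = i - 1 - 1 := by
  have h : (2 : Fin N) = 1 + 1 := by
    ext
    simp [Fin.val_add]
  rw [h, sub_sub]

lemma cycle_induction {P : Fin N → Prop} (j : Fin N) (h0 : P j) (hs : ∀ i, P i → P (i + 1))
    (i : Fin N) : P i := by
  have h : ∀ n : ℕ, P (j + Fin.ofNat N n) := by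
    intro n
    induction n with
    | zero => simpa using h0
    | succ n ih => rw [ofNat_succ, ← add_assoc]; exact hs _ ih
  have := h (i - j).val
  rwa [show Fin.ofNat N (i - j).val = i - j from Fin.ofNat_val_eq_self _, add_sub_cancel] at this

/-- Telescoping along the arc from i to j that does not wrap past N. -/
lemma norm_sub_le_sum (u : Fin N → E) (i j : Fin N) :
    ‖u i - u j‖ ≤ ∑ k, ‖u k - u (k + 1)‖ := by
  wlog hij : i ≤ j generalizing i j
  · rw [norm_sub_rev]
    exact this j i (le_of_not_ge hij)
  have h := dist_le_Ico_sum_dist (fun n => u (Fin.ofNat N n)) (Fin.le_def.1 hij)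
  simp only [Fin.ofNat_val_eq_self, dist_eq_norm, ofNat_succ] at h
  refine h.trans ?_
  have h2 : ∑ k, ‖u k - u (k + 1)‖ =
      ∑ n ∈ Finset.range N, ‖u (Fin.ofNat N n) - u (Fin.ofNat N n + 1)‖ := by
    rw [Finset.sum_range]
    simp
  rw [h2]
  refine Finset.sum_le_sum_of_subset_of_nonneg ?_ fun _ _ _ => norm_nonneg _
  intro n hn
  rw [Finset.mem_Ico] at hn
  exact Finset.mem_range.2 (hn.2.trans j.isLt)

lemma sum_norm_sq_le (u : Fin N → E) :
    (∑ k, ‖u k - u (k + 1)‖) ^ 2 ≤ 2 * N * disagreement u := by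
  have h := sq_sum_le_card_mul_sum_sq (s := (Finset.univ : Finset (Fin N)))
    (f := fun k => ‖u k - u (k + 1)‖)
  rw [Finset.card_univ, Fintype.card_fin] at h
  unfold disagreement
  linarith

variable [InnerProductSpace ℝ E]

/-- The graph Laplacian of the cycle. -/
def cycleLaplacian (u : Fin N → E) (i : Fin N) : E := (2 : ℝ) • u i - u (i - 1) - u (i + 1)

/-- Summation by parts on the cycle. -/
lemma sum_inner_cycle (u v : Fin N → E) :
    ∑ i, inner ℝ (u i - u (i + 1)) (v i - v (i + 1)) = ∑ i, inner ℝ (cycleLaplacian u i) (v i) := by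
  have h1 : ∑ i, inner ℝ (u i - u (i + 1)) (v (i + 1)) = ∑ i, inner ℝ (u (i - 1) - u i) (v i) := by
    rw [← sum_add_one fun i => inner ℝ (u (i - 1) - u i) (v i)]
    simp
  simp only [inner_sub_right, Finset.sum_sub_distrib]
  rw [h1, ← Finset.sum_sub_distrib]
  refine Finset.sum_congr rfl fun i _ => ?_
  rw [← inner_sub_left, cycleLaplacian, two_smul]
  congr 1
  abel

lemma sum_cycleLaplacian (u : Fin N → E) : ∑ i, cycleLaplacian u i = 0 := by
  simp only [cycleLaplacian, Finset.sum_sub_distrib, sum_sub_one, sum_add_one, two_smul,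
    Finset.sum_add_distrib]
  abel

/-- Poincaré inequality: 2Y ≤ XZ and X² ≤ 2NY together give Y ≤ NZ², and Cauchy–Schwarz bounds Z².
-/
lemma disagreement_le (u : Fin N → E) :
    disagreement u ≤ N ^ 2 * ∑ i, ‖cycleLaplacian u i‖ ^ 2 := by
  set X := ∑ k, ‖u k - u (k + 1)‖
  set Y := disagreement u with hY
  set Z := ∑ i, ‖cycleLaplacian u i‖
  have hX0 : 0 ≤ X := by positivity
  have hZ0 : 0 ≤ Z := by positivity
  have hY0 : 0 ≤ Y := disagreement_nonneg u
  have h1 : 2 * Y ≤ X * Z := by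
    -- The Laplacian sums to zero, so the constant u 0 may be subtracted.
    have e1 : 2 * Y = ∑ i, inner ℝ (cycleLaplacian u i) (u i - u 0) := by
      simp only [inner_sub_right, Finset.sum_sub_distrib]
      rw [← sum_inner, sum_cycleLaplacian, inner_zero_left, sub_zero, ← sum_inner_cycle, hY,
        disagreement]
      simp only [real_inner_self_eq_norm_sq]
      ring
    rw [e1, Finset.mul_sum]
    refine Finset.sum_le_sum fun i _ => (real_inner_le_norm _ _).trans ?_
    rw [mul_comm]
    gcongr
    exact norm_sub_le_sum u i 0
  have h2 : X ^ 2 ≤ 2 * N * Y := sum_norm_sq_le u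
  have h3 : Z ^ 2 ≤ N * ∑ i, ‖cycleLaplacian u i‖ ^ 2 := by
    have h := sq_sum_le_card_mul_sum_sq (s := (Finset.univ : Finset (Fin N)))
      (f := fun k => ‖cycleLaplacian u k‖)
    rwa [Finset.card_univ, Fintype.card_fin] at h
  have h4 : Y ≤ N * Z ^ 2 := by
    rcases hY0.eq_or_lt with h | h
    · rw [← h]; positivity
    · have h5 : (2 * Y) ^ 2 ≤ X ^ 2 * Z ^ 2 := by
        rw [← mul_pow]
        exact pow_le_pow_left₀ (by linarith) h1 2
      have h6 : X ^ 2 * Z ^ 2 ≤ 2 * N * Y * Z ^ 2 := mul_le_mul_of_nonneg_right h2 (sq_nonneg _)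
      have h7 : 0 ≤ N * Z ^ 2 := by positivity
      refine le_of_mul_le_mul_left ?_ h
      nlinarith
  calc Y ≤ N * Z ^ 2 := h4
    _ ≤ N * (N * ∑ i, ‖cycleLaplacian u i‖ ^ 2) := by gcongr
    _ = _ := by ring

lemma hasDerivWithinAt_disagreement {u : ℝ → Fin N → E} {u' : Fin N → E} {s : Set ℝ} {t : ℝ}
    (hu : ∀ i, HasDerivWithinAt (fun x => u x i) (u' i) s t) :
    HasDerivWithinAt (fun x => disagreement (u x)) (∑ i, inner ℝ (cycleLaplacian (u t) i) (u' i))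
      s t := by
  have h := (HasDerivWithinAt.fun_sum (u := Finset.univ) fun i _ =>
    ((hu i).sub (hu (i + 1))).norm_sq).const_mul (1 / 2 : ℝ)
  refine h.congr_deriv ?_
  rw [← Finset.mul_sum, ← mul_assoc, ← sum_inner_cycle]
  norm_num

/-- The balance carries a positive entry to its successor and so around the whole cycle,
contradicting the zero sum; the same applies to -D. -/
lemma eq_zero_of_cycle_balance {a b D : Fin N → ℝ} (ha : ∀ i, 0 < a i) (hb : ∀ i, 0 < b i)
    (hsum : ∑ i, D i = 0) (h : ∀ i, D i * a i = D (i - 1) * b (i - 1)) : D = 0 := by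
  have key : ∀ D : Fin N → ℝ, ∑ i, D i = 0 → (∀ i, D i * a i = D (i - 1) * b (i - 1)) →
      ∀ j, D j ≤ 0 := by
    intro D hsum h j
    by_contra! hj
    have hpos : ∀ i, 0 < D i := cycle_induction j hj fun i hi => by
      have h1 := h (i + 1)
      rw [add_sub_cancel_right] at h1
      exact pos_of_mul_pos_left (h1 ▸ mul_pos hi (hb i)) (ha _).le
    have : 0 < ∑ i, D i := Finset.sum_pos (fun i _ => hpos i) Finset.univ_nonempty
    linarith
  funext j
  refine le_antisymm (key D hsum h j) ?_
  have := key (fun i => -D i) (by simp [hsum]) (fun i => by simpa using h i) j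
  simpa using this

/-- With weights in a compact interval of positive numbers, the weighted cyclic differences of a
family of mean zero control the family. -/
lemma exists_cycle_coercive (N : ℕ) [NeZero N] {c : ℝ} (hc : 0 < c) (C : ℝ) :
    ∃ k > 0, ∀ a b D : Fin N → ℝ, (∀ i, a i ∈ Icc c C) → (∀ i, b i ∈ Icc c C) →
      ∑ i, D i = 0 → k * ∑ i, D i ^ 2 ≤ ∑ i, (D i * a i - D (i - 1) * b (i - 1)) ^ 2 := by
  -- By homogeneity D may be normalised; the quadratic form then attains a positive minimum on a
  -- compact set of weights and unit vectors.
  let J : Set (Fin N → ℝ) := Icc (fun _ => c) (fun _ => C)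
  let S : Set ((Fin N → ℝ) × (Fin N → ℝ) × (Fin N → ℝ)) :=
    (J ×ˢ J ×ˢ Icc (fun _ => -1) (fun _ => 1)) ∩
      {x | ∑ i, x.2.2 i ^ 2 = 1 ∧ ∑ i, x.2.2 i = 0}
  let f : (Fin N → ℝ) × (Fin N → ℝ) × (Fin N → ℝ) → ℝ := fun x =>
    ∑ i, (x.2.2 i * x.1 i - x.2.2 (i - 1) * x.2.1 (i - 1)) ^ 2
  have hf : Continuous f := by fun_prop
  have hS : IsCompact S := by
    refine (isCompact_Icc.prod (isCompact_Icc.prod isCompact_Icc)).inter_right ?_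
    exact (isClosed_eq (by fun_prop) continuous_const).inter
      (isClosed_eq (by fun_prop) continuous_const)
  have hpos : ∀ x ∈ S, 0 < f x := by
    rintro ⟨a, b, D⟩ ⟨⟨ha, hb, -⟩, h1, h0⟩
    refine (Finset.sum_nonneg fun i _ => sq_nonneg _).lt_of_ne' fun hzero => ?_
    have h2 : D = 0 := by
      refine eq_zero_of_cycle_balance (a := a) (b := b) (fun i => hc.trans_le (ha.1 i))
        (fun i => hc.trans_le (hb.1 i)) h0 fun i => ?_
      have := (Finset.sum_eq_zero_iff_of_nonneg fun i _ => sq_nonneg _).1 hzero i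
        (Finset.mem_univ i)
      exact sub_eq_zero.1 (pow_eq_zero_iff two_ne_zero |>.1 this)
    simp [h2] at h1
  obtain ⟨k, hk, hkS⟩ : ∃ k > 0, ∀ x ∈ S, k ≤ f x := by
    rcases S.eq_empty_or_nonempty with h | h
    -- For N = 1 no unit vector has zero sum.
    · exact ⟨1, one_pos, by simp [h]⟩
    · obtain ⟨x, hx, hmin⟩ := hS.exists_isMinOn h hf.continuousOn
      exact ⟨f x, hpos x hx, fun y hy => hmin hy⟩
  refine ⟨k, hk, fun a b D ha hb hD => ?_⟩
  set s := ∑ i, D i ^ 2 with hs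
  have hs0 : 0 ≤ s := Finset.sum_nonneg fun i _ => sq_nonneg _
  rcases hs0.eq_or_lt with h | h
  · rw [← h, mul_zero]
    exact Finset.sum_nonneg fun i _ => sq_nonneg _
  have hsq : √s ^ 2 = s := Real.sq_sqrt hs0
  have hsum : ∑ i, (D i / √s) ^ 2 = 1 := by
    simp only [div_pow, hsq, ← Finset.sum_div, ← hs]
    exact div_self h.ne'
  have hle : ∀ i, |D i / √s| ≤ 1 := by
    intro i
    rw [← sq_le_one_iff_abs_le_one, ← hsum]
    exact Finset.single_le_sum (f := fun i => (D i / √s) ^ 2) (fun i _ => sq_nonneg _)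
      (Finset.mem_univ i)
  have hmem : (a, b, fun i => D i / √s) ∈ S := by
    refine ⟨⟨⟨fun i => (ha i).1, fun i => (ha i).2⟩, ⟨fun i => (hb i).1, fun i => (hb i).2⟩,
      ⟨fun i => (abs_le.1 (hle i)).1, fun i => (abs_le.1 (hle i)).2⟩⟩, hsum, ?_⟩
    simp only [← Finset.sum_div, hD, zero_div]
  have hfin := hkS _ hmem
  have heq : f (a, b, fun i => D i / √s) =
      (∑ i, (D i * a i - D (i - 1) * b (i - 1)) ^ 2) / s := by
    simp only [f, Finset.sum_div]
    refine Finset.sum_congr rfl fun i _ => ?_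
    rw [eq_div_iff h.ne', ← hsq, ← mul_pow]
    congr 1
    have : √s ≠ 0 := (Real.sqrt_pos.2 h).ne'
    rw [Real.sqrt_sq (Real.sqrt_nonneg s)]
    field_simp
  rw [heq, le_div_iff₀ h] at hfin
  exact hfin

end Cycle

/-! ### Decay of the Lyapunov function. -/

/-- Grönwall: exp(l t) y(t) is antitone. -/
lemma tendsto_zero_of_deriv_le {y y' : ℝ → ℝ} {l : ℝ} (hl : 0 < l) (hy0 : ∀ t, 0 ≤ y t)
    (hy : ∀ t, 0 ≤ t → HasDerivWithinAt y (y' t) (Ici 0) t)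
    (hle : ∀ t, 0 ≤ t → y' t ≤ -l * y t) : Tendsto y atTop (𝓝 0) := by
  have hz : ∀ t, 0 ≤ t → HasDerivWithinAt (fun t => Real.exp (l * t) * y t)
      (Real.exp (l * t) * (l * y t + y' t)) (Ici 0) t := by
    intro t ht
    have h1 : HasDerivWithinAt (fun t => Real.exp (l * t)) (Real.exp (l * t) * l) (Ici 0) t := by
      simpa using (((hasDerivAt_id t).const_mul l).exp).hasDerivWithinAt
    exact (h1.mul (hy t ht)).congr_deriv (by ring)
  have hanti : AntitoneOn (fun t => Real.exp (l * t) * y t) (Ici 0) := by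
    refine antitoneOn_of_hasDerivWithinAt_nonpos (convex_Ici 0)
      (fun t ht => (hz t ht).continuousWithinAt)
      (fun t ht => (hz t (interior_subset ht)).mono interior_subset) fun t ht => ?_
    refine mul_nonpos_of_nonneg_of_nonpos (Real.exp_pos _).le ?_
    linarith [hle t (interior_subset ht)]
  have hexp : Tendsto (fun t => Real.exp (-(l * t)) * y 0) atTop (𝓝 0) := by
    have := (Real.tendsto_exp_neg_atTop_nhds_zero.comp
      (tendsto_id.const_mul_atTop hl)).mul_const (y 0)
    simpa using this
  refine squeeze_zero' (Eventually.of_forall hy0) ?_ hexp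
  filter_upwards [eventually_ge_atTop 0] with t ht
  have h := hanti (mem_Ici.2 le_rfl) (mem_Ici.2 ht) ht
  simp only [mul_zero, Real.exp_zero, one_mul] at h
  calc y t = Real.exp (-(l * t)) * (Real.exp (l * t) * y t) := by
        rw [← mul_assoc, ← Real.exp_add]; simp
    _ ≤ _ := by gcongr

lemma hasFDerivAt_workload_apply {Ω : Set Plane} {ρ : Plane → ℝ} {α β : ℝ} {p : Plane}
    (h : DifferentiableAt ℝ (fun x : ℝ × ℝ × Plane => workload Ω ρ x.1 x.2.1 x.2.2) (α, β, p)) :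
    HasDerivAt (fun a => workload Ω ρ a β p) (deriv (fun a => workload Ω ρ a β p) α) α ∧
    HasDerivAt (fun b => workload Ω ρ α b p) (deriv (fun b => workload Ω ρ α b p) β) β ∧
    HasGradientAt (fun x => workload Ω ρ α β x) (∇ (fun x => workload Ω ρ α β x) p) p ∧
    ∀ (x y : ℝ) (v : Plane),
      fderiv ℝ (fun x : ℝ × ℝ × Plane => workload Ω ρ x.1 x.2.1 x.2.2) (α, β, p) (x, y, v) =
        deriv (fun a => workload Ω ρ a β p) α * x + deriv (fun b => workload Ω ρ α b p) β * y +
          inner ℝ (∇ (fun x => workload Ω ρ α β x) p) v := by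
  set L := fderiv ℝ (fun x : ℝ × ℝ × Plane => workload Ω ρ x.1 x.2.1 x.2.2) (α, β, p)
  have hL := h.hasFDerivAt
  have h1 : HasDerivAt (fun a => workload Ω ρ a β p) (L (1, 0, 0)) α :=
    hL.comp_hasDerivAt (f := fun a : ℝ => (a, β, p)) α
      ((hasDerivAt_id α).prodMk (hasDerivAt_const α (β, p)))
  have h2 : HasDerivAt (fun b => workload Ω ρ α b p) (L (0, 1, 0)) β :=
    hL.comp_hasDerivAt (f := fun b : ℝ => (α, b, p)) β
      ((hasDerivAt_const β α).prodMk ((hasDerivAt_id β).prodMk (hasDerivAt_const β p)))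
  have h3 : HasFDerivAt (fun x => workload Ω ρ α β x)
      (L.comp ((0 : Plane →L[ℝ] ℝ).prod ((0 : Plane →L[ℝ] ℝ).prod (.id ℝ Plane)))) p :=
    hL.comp (f := fun x : Plane => (α, β, x)) p
      ((hasFDerivAt_const α p).prodMk ((hasFDerivAt_const β p).prodMk (hasFDerivAt_id p)))
  have h4 := h3.differentiableAt.hasGradientAt
  refine ⟨h1.differentiableAt.hasDerivAt, h2.differentiableAt.hasDerivAt, h4, fun x y v => ?_⟩
  have h5 : inner ℝ (∇ (fun x => workload Ω ρ α β x) p) v = L (0, 0, v) := by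
    have := congrArg (fun T => T v) (h4.hasFDerivAt.unique h3)
    simpa using this
  rw [h1.deriv, h2.deriv, h5]
  have h6 : ((x, y, v) : ℝ × ℝ × Plane) = x • (1, 0, 0) + y • (0, 1, 0) + (0, 0, v) := by simp
  rw [h6, map_add, map_add, map_smul, map_smul]
  simp only [smul_eq_mul]
  ring

lemma half_norm_sq_sub_le {E : Type*} [NormedAddCommGroup E] [InnerProductSpace ℝ E] {g v : E}
    {d G : ℝ} (hg : ‖g‖ ≤ G) : 1 / 2 * ‖v‖ ^ 2 - G ^ 2 * d ^ 2 ≤ ‖d • g + v‖ ^ 2 := by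
  have h1 : ‖d • g‖ ^ 2 ≤ G ^ 2 * d ^ 2 := by
    rw [norm_smul, mul_pow, Real.norm_eq_abs, sq_abs, mul_comm]
    gcongr
  have h2 : ‖v‖ ≤ ‖d • g + v‖ + ‖d • g‖ := by
    simpa using norm_sub_le (d • g + v) (d • g)
  nlinarith [norm_nonneg v, sq_nonneg (‖d • g + v‖ - ‖d • g‖)]

/-- Here x and y stand for the squared Laplacians of m and r, e and h for the two dissipation sums,
v and w for the two disagreements. -/
lemma exists_decay_rate {κφ κr k : ℝ} (hκφ : 0 < κφ) (hκr : 0 < κr) (hk : 0 < k) (G : ℝ)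
    {n : ℝ} (hn : 0 < n) :
    ∃ l > 0, ∀ x y e h v w : ℝ, 0 ≤ x → 0 ≤ y → 0 ≤ h → k * x ≤ e →
      1 / 2 * y - G ^ 2 * x ≤ h → v ≤ n * x → w ≤ n * y → -κφ * e - κr * h ≤ -l * (v + w) := by
  -- Only a fraction θ of the point dissipation is spent, so that its error θκr G²x uses at most
  -- half of κφ k x.
  set θ := min 1 (κφ * k / (2 * (κr * G ^ 2 + 1))) with hθ
  have hd : 0 < κr * G ^ 2 + 1 := by positivity
  have hθ0 : 0 < θ := lt_min one_pos (by positivity)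
  have hθ1 : θ ≤ 1 := min_le_left _ _
  have hθ2 : θ * (κr * G ^ 2) ≤ κφ * k / 2 := by
    have h1 : θ * (2 * (κr * G ^ 2 + 1)) ≤ κφ * k := by
      rw [← le_div_iff₀ (by positivity)]
      exact min_le_right _ _
    linarith
  set μ := min (κφ * k / 2) (θ * κr / 2)
  have hμ : 0 < μ := lt_min (by positivity) (by positivity)
  refine ⟨μ / n, by positivity, fun x y e h v w hx hy hh he hle hv hw => ?_⟩
  have h1 : μ / n * (v + w) ≤ μ * (x + y) := by
    calc μ / n * (v + w) ≤ μ / n * (n * x + n * y) := by gcongr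
      _ = μ * (x + y) := by field_simp
  have h2 : μ * x ≤ κφ * k / 2 * x := by gcongr; exact min_le_left _ _
  have h3 : μ * y ≤ θ * κr / 2 * y := by gcongr; exact min_le_right _ _
  have h4 : κφ * (k * x) ≤ κφ * e := by gcongr
  have h5 : θ * κr * (1 / 2 * y - G ^ 2 * x) ≤ κr * h := by
    calc θ * κr * (1 / 2 * y - G ^ 2 * x) ≤ θ * κr * h := by gcongr
      _ ≤ 1 * κr * h := by gcongr
      _ = κr * h := by ring
  have h6 : θ * (κr * G ^ 2) * x ≤ κφ * k / 2 * x := by gcongr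
  nlinarith

lemma workloadDiff_eq_cycleLaplacian {N : ℕ} [NeZero N] (Ω : Set Plane) (ρ : Plane → ℝ)
    (φ : Fin N → ℝ) (r : Fin N → Plane) (i : Fin N) :
    workloadDiff Ω ρ φ r i = cycleLaplacian (agentWorkload Ω ρ φ r) i := rfl

/-- The partition dynamics is the scaled gradient flow of the total disagreement. -/
lemma hasDerivWithinAt_total_disagreement {N : ℕ} [NeZero N] {Ω : Set Plane} {ρ : Plane → ℝ}
    {κφ κr : ℝ} {φ : ℝ → Fin N → ℝ} {r : ℝ → Fin N → Plane}
    (hsol : SolvesPartitionDynamics Ω ρ κφ κr φ r) {t : ℝ} (ht : 0 ≤ t)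
    (hdiff : ∀ i : Fin N, DifferentiableAt ℝ
      (fun x : ℝ × ℝ × Plane => workload Ω ρ x.1 x.2.1 x.2.2) (φ t i, φ t (i + 1), r t i)) :
    HasDerivWithinAt
      (fun s => disagreement (agentWorkload Ω ρ (φ s) (r s)) + disagreement (r s))
      (-κφ * ∑ i, (workloadDiff Ω ρ (φ t) (r t) i *
            -deriv (fun a => workload Ω ρ a (φ t (i + 1)) (r t i)) (φ t i) -
          workloadDiff Ω ρ (φ t) (r t) (i - 1) *
            deriv (fun b => workload Ω ρ (φ t (i - 1)) b (r t (i - 1))) (φ t (i - 1 + 1))) ^ 2 -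
        κr * ∑ i, ‖workloadDiff Ω ρ (φ t) (r t) i •
            ∇ (fun p => workload Ω ρ (φ t i) (φ t (i + 1)) p) (r t i) +
          cycleLaplacian (r t) i‖ ^ 2) (Ici 0) t := by
  set A : Fin N → ℝ := fun i => deriv (fun a => workload Ω ρ a (φ t (i + 1)) (r t i)) (φ t i)
    with hA
  set B : Fin N → ℝ := fun i => deriv (fun b => workload Ω ρ (φ t i) b (r t i)) (φ t (i + 1))
    with hB
  set g : Fin N → Plane := fun i => ∇ (fun p => workload Ω ρ (φ t i) (φ t (i + 1)) p) (r t i)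
    with hg
  set D : Fin N → ℝ := workloadDiff Ω ρ (φ t) (r t) with hD
  have hφ' : ∀ i, angleField Ω ρ κφ (φ t) (r t) i = -κφ * (D i * A i + D (i - 1) * B (i - 1)) := by
    intro i
    simp only [hA, hB, hD, angleField, workloadDiff, sub_add_cancel, sub_two_eq]
  have hr' : ∀ i, pointField Ω ρ κr (φ t) (r t) i = (-κr) • (D i • g i + cycleLaplacian (r t) i) :=
    fun i => rfl
  have hm : ∀ i, HasDerivWithinAt (fun s => agentWorkload Ω ρ (φ s) (r s) i)
      (A i * angleField Ω ρ κφ (φ t) (r t) i + B i * angleField Ω ρ κφ (φ t) (r t) (i + 1) +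
        inner ℝ (g i) (pointField Ω ρ κr (φ t) (r t) i)) (Ici 0) t := by
    intro i
    obtain ⟨-, -, -, happly⟩ := hasFDerivAt_workload_apply (hdiff i)
    refine ((hdiff i).hasFDerivAt.comp_hasDerivWithinAt
      (f := fun s => (φ s i, φ s (i + 1), r s i)) t
      ((hsol.angle t ht i).prodMk ((hsol.angle t ht (i + 1)).prodMk (hsol.point t ht i)))).congr_deriv
      (happly _ _ _)
  refine ((hasDerivWithinAt_disagreement hm).add
    (hasDerivWithinAt_disagreement (hsol.point t ht))).congr_deriv ?_
  -- Reindexing collects both contributions of the velocity of φᵢ, which complete the square.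
  have hshift : ∑ i, D i * (B i * angleField Ω ρ κφ (φ t) (r t) (i + 1)) =
      ∑ i, D (i - 1) * (B (i - 1) * angleField Ω ρ κφ (φ t) (r t) i) := by
    rw [← sum_add_one fun i => D (i - 1) * (B (i - 1) * angleField Ω ρ κφ (φ t) (r t) i)]
    simp only [add_sub_cancel_right]
  have hcalc : ∑ i, inner ℝ (cycleLaplacian (agentWorkload Ω ρ (φ t) (r t)) i)
        (A i * angleField Ω ρ κφ (φ t) (r t) i + B i * angleField Ω ρ κφ (φ t) (r t) (i + 1) +
          inner ℝ (g i) (pointField Ω ρ κr (φ t) (r t) i)) =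
      ∑ i, D i * (A i * angleField Ω ρ κφ (φ t) (r t) i) +
        ∑ i, D i * (B i * angleField Ω ρ κφ (φ t) (r t) (i + 1)) +
        ∑ i, D i * inner ℝ (g i) (pointField Ω ρ κr (φ t) (r t) i) := by
    rw [← Finset.sum_add_distrib, ← Finset.sum_add_distrib]
    refine Finset.sum_congr rfl fun i _ => ?_
    rw [← workloadDiff_eq_cycleLaplacian, RCLike.inner_apply, conj_trivial]
    ring
  rw [hcalc, hshift, ← Finset.sum_add_distrib, add_assoc, ← Finset.sum_add_distrib,
    Finset.mul_sum, Finset.mul_sum, sub_eq_add_neg, ← Finset.sum_neg_distrib]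
  congr 1
  · refine Finset.sum_congr rfl fun i _ => ?_
    change _ = -κφ * (D i * -A i - D (i - 1) * B (i - 1)) ^ 2
    rw [hφ']
    ring
  · refine Finset.sum_congr rfl fun i _ => ?_
    rw [hr', ← real_inner_smul_left, ← inner_add_left, real_inner_smul_right,
      real_inner_self_eq_norm_sq, neg_mul]

lemma infDist_consensusSet_le {N : ℕ} [NeZero N] (m : Fin N → ℝ) (r : Fin N → Plane) :
    Metric.infDist (m, r) (consensusSet N) ≤ 2 * √(2 * N * (disagreement m + disagreement r)) := by
  have hmem : ((fun _ => m 0, fun _ => r 0) : (Fin N → ℝ) × (Fin N → Plane)) ∈ consensusSet N :=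
    fun i j => ⟨rfl, rfl⟩
  refine (Metric.infDist_le_dist_of_mem hmem).trans ?_
  set s := √(2 * N * (disagreement m + disagreement r))
  have hm : ∑ k, ‖m k - m (k + 1)‖ ≤ s := by
    refine Real.le_sqrt_of_sq_le ((sum_norm_sq_le m).trans ?_)
    gcongr
    linarith [disagreement_nonneg r]
  have hr : ∑ k, ‖r k - r (k + 1)‖ ≤ s := by
    refine Real.le_sqrt_of_sq_le ((sum_norm_sq_le r).trans ?_)
    gcongr
    linarith [disagreement_nonneg m]
  have hs : 0 ≤ s := Real.sqrt_nonneg _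
  rw [Prod.dist_eq]
  refine (max_le ?_ ?_ : _ ≤ s).trans (by linarith)
  · refine (dist_pi_le_iff hs).2 fun i => ?_
    rw [dist_eq_norm]
    exact (norm_sub_le_sum m i 0).trans hm
  · refine (dist_pi_le_iff hs).2 fun i => ?_
    rw [dist_eq_norm]
    exact (norm_sub_le_sum r i 0).trans hr

end RotaryCoverage

open RotaryCoverage MeasureTheory Set Filter Topology

theorem lemma2 {N : ℕ} [NeZero N]
    (Ω : Set RotaryCoverage.Plane) (hΩ : MeasurableSet Ω) (hΩb : Bornology.IsBounded Ω)
    (ρ : RotaryCoverage.Plane → ℝ)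
    (hρ : MeasureTheory.AEStronglyMeasurable ρ (MeasureTheory.volume.restrict Ω))
    (ρlo ρhi : ℝ) (hρlo : 0 < ρlo) (hρb : ∀ q ∈ Ω, ρ q ∈ Set.Icc ρlo ρhi)
    (κφ κr : ℝ) (hκφ : 0 < κφ) (hκr : 0 < κr)
    (φ : ℝ → Fin N → ℝ) (r : ℝ → Fin N → RotaryCoverage.Plane)
    (hsol : RotaryCoverage.SolvesPartitionDynamics Ω ρ κφ κr φ r)
    (hdiff : ∀ t : ℝ, 0 ≤ t → ∀ i : Fin N,
      DifferentiableAt ℝ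
        (fun x : ℝ × ℝ × RotaryCoverage.Plane =>
          RotaryCoverage.workload Ω ρ x.1 x.2.1 x.2.2)
        (φ t i, φ t (i + 1), r t i))
    (K : Set RotaryCoverage.Plane) (hK : IsCompact K) (hKΩ : K ⊆ interior Ω)
    (hr : ∀ t : ℝ, 0 ≤ t → ∀ i : Fin N, r t i ∈ K) :
    Filter.Tendsto
      (fun t => Metric.infDist (RotaryCoverage.agentWorkload Ω ρ (φ t) (r t), r t)
        (RotaryCoverage.consensusSet N))
      Filter.atTop (nhds 0) := by
  obtain ⟨R, hR⟩ := Metric.isBounded_iff.1 hΩb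
  simp only [dist_eq_norm] at hR
  have hsub : ∀ t, 0 ≤ t → ∀ i, r t i ∈ Ω := fun t ht i => interior_subset (hKΩ (hr t ht i))
  have hR0 : 0 ≤ R := (norm_nonneg _).trans (hR (hsub 0 le_rfl 0) (hsub 0 le_rfl 0))
  -- Compactness yields one radius δ for all times and agents, making the decay rate independent of
  -- time.
  obtain ⟨δ, hδ, hthick⟩ := hK.exists_thickening_subset_open isOpen_interior hKΩ
  have hball : ∀ t, 0 ≤ t → ∀ i, Metric.ball (r t i) δ ⊆ Ω := fun t ht i =>
    (Metric.ball_subset_thickening (hr t ht i) δ).trans (hthick.trans interior_subset)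
  have hint : IntegrableOn ρ Ω := by
    refine IntegrableOn.of_bound hΩb.measure_lt_top hρ |ρhi| ?_
    filter_upwards [ae_restrict_mem hΩ] with q hq
    rw [Real.norm_eq_abs, abs_of_pos (hρlo.trans_le (hρb q hq).1)]
    exact (hρb q hq).2.trans (le_abs_self _)
  set c := ρlo * (δ ^ 2 / 16)
  set C := |ρhi| * (4 * R ^ 2)
  set G := |ρhi| * (8 * R)
  have hc : 0 < c := by positivity
  have hN : (0 : ℝ) < (N : ℝ) ^ 2 := by
    have : (N : ℝ) ≠ 0 := Nat.cast_ne_zero.2 (NeZero.ne N)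
    positivity
  obtain ⟨k, hk, hcoer⟩ := exists_cycle_coercive N hc C
  obtain ⟨l, hl, hdecay⟩ := exists_decay_rate hκφ hκr hk G hN
  have hV := tendsto_zero_of_deriv_le hl
    (fun t => add_nonneg (disagreement_nonneg (agentWorkload Ω ρ (φ t) (r t)))
      (disagreement_nonneg (r t)))
    (fun t ht => hasDerivWithinAt_total_disagreement hsol ht (hdiff t ht)) ?_
  · refine squeeze_zero (fun t => Metric.infDist_nonneg)
      (fun t => infDist_consensusSet_le (agentWorkload Ω ρ (φ t) (r t)) (r t)) ?_
    have := ((hV.const_mul (2 * (N : ℝ))).sqrt).const_mul 2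
    simpa using this
  · intro t ht
    have hpart := fun i => hasFDerivAt_workload_apply (hdiff t ht i)
    have hRi : ∀ i, ∀ q ∈ Ω, ‖q - r t i‖ ≤ R := fun i q hq => hR hq (hsub t ht i)
    refine hdecay (∑ i, workloadDiff Ω ρ (φ t) (r t) i ^ 2)
      (∑ i, ‖cycleLaplacian (r t) i‖ ^ 2) _ _ _ _ (by positivity) (by positivity)
      (by positivity) ?_ ?_ ?_ (disagreement_le _)
    · refine hcoer (fun i => -deriv (fun a => workload Ω ρ a (φ t (i + 1)) (r t i)) (φ t i))
        (fun i => deriv (fun b => workload Ω ρ (φ t i) b (r t i)) (φ t (i + 1)))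
        (workloadDiff Ω ρ (φ t) (r t)) (fun i => ?_) (fun i => ?_)
        (sum_cycleLaplacian (agentWorkload Ω ρ (φ t) (r t)))
      · exact hasDerivAt_workload_left_mem hint hΩ hρlo hρb (hRi i) hR0 hδ (hball t ht i)
          (hpart i).1
      · exact hasDerivAt_workload_right_mem hint hΩ hρlo hρb (hRi i) hR0 hδ (hball t ht i)
          (hpart i).2.1
    · rw [Finset.mul_sum, Finset.mul_sum, ← Finset.sum_sub_distrib]
      refine Finset.sum_le_sum fun i _ => half_norm_sq_sub_le ?_
      exact norm_gradient_workload_le hint hΩ hρlo hρb (fun q hq q' hq' => hR hq hq') hR0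
        (hKΩ (hr t ht i)) (hpart i).2.2.1
    · refine (disagreement_le _).trans_eq ?_
      simp only [workloadDiff_eq_cycleLaplacian, Real.norm_eq_abs, sq_abs]
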